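/- Conventions. Let $s\ge 1$ be an integer, $q$ a prime power, $q=p^e$, and let $\mathbb{Z}_q$ be the ring of $q$-adic integers (as a topological ring $\mathbb{Z}_q=\mathbb{Z}_p$); every $z\in\mathbb{Z}_q$ has a unique expansion $z=\sum_{r\ge 0}a_rq^r$ with digits $a_r\in Z_q:=\{0,1,\dots,q-1\}$. For a sequence $\mathcal{S}=(\boldsymbol{x}_n)_{n\ge 0}$ in $[0,1]^s$ and $N\ge 1$ let $$D_N^*(\mathcal{S})=\sup_J\left|\frac{\#\{0\le n<N:\boldsymbol{x}_n\in J\}}{N}-\mathrm{vol}(J)\right|,$$ where the supremum is over all boxes $J=J_1\times\cdots\times J_s$ with each $J_i$ of the form $[0,u_i)$ or $[0,u_i]$, $0\le u_i\le 1$. The sequence $\mathcal{S}$ is called a low-discrepancy sequence if there are constants $c>0$ and $K$, independent of $N$, such that $N D_N^*(\mathcal{S})\le c(\log N)^s+K(\log N)^{s-1}$ for all $N\ge 2$. Statement. Let $t\ge 0$ be an integer and let $C^{(i)}=(c^{(i)}_{j,r})_{j\ge 1,r\ge 0}$, $1\le i\le s$, be matrices over the finite field $\mathbb{F}_q$ such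 that every row of every $C^{(i)}$ has only finitely many nonzero entries. Assume that for every integer $m>t$ and all integers $d_1,\dots,d_s\ge 0$ with $1\le d_1+\cdots+d_s\le m-t$ the $(d_1+\cdots+d_s)\times m$ matrix with the rows $(c^{(i)}_{j,0},\dots,c^{(i)}_{j,m-1})$, $1\le j\le d_i$, $1\le i\le s$, has rank $d_1+\cdots+d_s$. Let $\psi_r:Z_q\to\mathbb{F}_q$ ($r\ge 0$) and $\lambda_{i,j}:\mathbb{F}_q\to Z_q$ ($1\le i\le s$, $j\ge 1$) be arbitrary bijections. Let $\alpha\in\mathbb{Z}_q$, let $v$ be a positive integer with $\gcd(v,q)=1$, and put $s_n=\frac{1}{v}n+\alpha\in\mathbb{Z}_q$ for $n\ge 0$. Let $\boldsymbol{x}_n\in[0,1]^s$ be the point whose $i$th coordinate is $$\boldsymbol{x}_n^{(i)}=\sum_{j=1}^\infty \lambda_{i,j}\left(\sum_{r=0}^\infty c^{(i)}_{j,r}\,\psi_r(a_r)\right)q^{-j},\qquad\text{where } s_n=\sum_{r=0}^\infty a_rq^r,\ a_r\in Z_q.$$ Then $(\boldsymbol{x}_n)_{n\ge 0}$ is a low-discrepancy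 sequence. -/

import Mathlib

namespace DigitalSeq

open Finset

section PadicDigits

variable (p : ℕ) [hp : Fact p.Prime] (e : ℕ)

/-- The digit `a_r` at position `r` of the base-`p ^ e` expansion
`x = ∑ r, a_r * (p ^ e) ^ r`, `0 ≤ a_r < p ^ e`, of `x : ℤ_[p]`. Here `x.appr (e * (r + 1))` is
the representative of `x` modulo `(p ^ e) ^ (r + 1)` in `{0, …, (p ^ e) ^ (r + 1) - 1}`. -/
noncomputable def padicDigit (x : ℤ_[p]) (r : ℕ) : Fin (p ^ e) :=
  ⟨x.appr (e * (r + 1)) / (p ^ e) ^ r, by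
    have h := x.appr_lt (e * (r + 1))
    refine Nat.div_lt_of_lt_mul (h.trans_eq ?_)
    rw [pow_mul, pow_succ]⟩

theorem sum_padicDigit (x : ℤ_[p]) (k : ℕ) :
    ∑ r ∈ range k, (padicDigit p e x r : ℕ) * (p ^ e) ^ r = x.appr (e * k) := by
  induction k with
  | zero =>
    have h := x.appr_lt 0
    simp only [pow_zero, Nat.lt_one_iff] at h
    simp [h]
  | succ k ih =>
    rw [sum_range_succ, ih]
    have hle : e * k ≤ e * (k + 1) := Nat.mul_le_mul_left e (Nat.le_succ k)
    have hd := x.dvd_appr_sub_appr _ _ hle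
    have hmono := x.appr_mono hle
    have hlt := x.appr_lt (e * k)
    obtain ⟨c, hc⟩ := hd
    have hx : x.appr (e * (k + 1)) = x.appr (e * k) + p ^ (e * k) * c := by omega
    have hpos : 0 < p ^ (e * k) := pow_pos hp.out.pos _
    simp only [padicDigit]
    rw [hx, ← pow_mul, Nat.add_mul_div_left _ _ hpos, Nat.div_eq_of_lt hlt]
    ring

/-- The digits are those of the `p ^ e`-adic expansion of `x`. -/
theorem hasSum_padicDigit (he : 0 < e) (x : ℤ_[p]) :
    HasSum (fun r => ((padicDigit p e x r : ℕ) : ℤ_[p]) * ((p ^ e : ℕ) : ℤ_[p]) ^ r) x := by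
  have key : ∀ k, ‖x - ∑ r ∈ range k,
      ((padicDigit p e x r : ℕ) : ℤ_[p]) * ((p ^ e : ℕ) : ℤ_[p]) ^ r‖
      ≤ (p : ℝ) ^ (-(e * k : ℕ) : ℤ) := by
    intro k
    have h := x.appr_spec (e * k)
    have h2 := congrArg (Nat.cast : ℕ → ℤ_[p]) (sum_padicDigit p e x k)
    push_cast at h2 ⊢
    rw [h2]
    exact_mod_cast (PadicInt.norm_le_pow_iff_mem_span_pow _ _).2 h
  have hsum : Summable
      (fun r => ((padicDigit p e x r : ℕ) : ℤ_[p]) * ((p ^ e : ℕ) : ℤ_[p]) ^ r) := by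
    have hp1 : (1 : ℝ) < p := by exact_mod_cast hp.out.one_lt
    refine Summable.of_norm_bounded (g := fun r => (((p : ℝ)⁻¹) ^ e) ^ r)
      (summable_geometric_of_lt_one (by positivity)
        (pow_lt_one₀ (by positivity) (inv_lt_one_of_one_lt₀ hp1) he.ne')) fun r => ?_
    rw [norm_mul, norm_pow]
    push_cast
    rw [norm_pow, PadicInt.norm_p]
    exact mul_le_of_le_one_left (by positivity) (PadicInt.norm_le_one _)
  refine (hsum.hasSum_iff_tendsto_nat).2 ?_
  rw [tendsto_iff_norm_sub_tendsto_zero]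
  have hp1 : (1 : ℝ) < p := by exact_mod_cast hp.out.one_lt
  have hz : Filter.Tendsto (fun k : ℕ => (((p : ℝ)⁻¹) ^ e) ^ k) Filter.atTop (nhds 0) :=
    tendsto_pow_atTop_nhds_zero_of_lt_one (by positivity)
      (pow_lt_one₀ (by positivity) (inv_lt_one_of_one_lt₀ hp1) he.ne')
  refine squeeze_zero (fun _ => norm_nonneg _) (fun k => ?_) hz
  rw [norm_sub_rev]
  refine (key k).trans_eq ?_
  rw [zpow_neg, zpow_natCast, ← pow_mul, inv_pow]

/-- The sequence `s_n = n / v + α` in `ℤ_[p]`; `PadicInt.inv v` is the inverse of `v` in `ℤ_[p]`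
as soon as `v` is a unit there (see `coe_fracShift`). -/
noncomputable def fracShift (v : ℕ) (α : ℤ_[p]) (n : ℕ) : ℤ_[p] :=
  (n : ℤ_[p]) * (v : ℤ_[p]).inv + α

theorem coe_fracShift {v : ℕ} (hv : v.Coprime (p ^ e)) (he : 0 < e) (α : ℤ_[p]) (n : ℕ) :
    (fracShift p v α n : ℚ_[p]) = (n : ℚ_[p]) / (v : ℚ_[p]) + (α : ℚ_[p]) := by
  have hpv : ¬ p ∣ v := fun h => by
    have h1 : v.Coprime p := Nat.Coprime.coprime_dvd_right (dvd_pow_self p he.ne') hv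
    exact hp.out.one_lt.ne' (Nat.Coprime.eq_one_of_dvd h1.symm h)
  have hn : ‖(v : ℤ_[p])‖ = 1 := by
    rw [PadicInt.norm_natCast_eq_one_iff]
    exact (Nat.Prime.coprime_iff_not_dvd hp.out).2 hpv
  have hinv := PadicInt.mul_inv hn
  have h2 : (v : ℚ_[p]) * (((v : ℤ_[p]).inv : ℤ_[p]) : ℚ_[p]) = 1 := by
    have := congrArg (fun z : ℤ_[p] => (z : ℚ_[p])) hinv
    simpa using this
  have hv0 : (v : ℚ_[p]) ≠ 0 := left_ne_zero_of_mul_eq_one h2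
  simp only [fracShift, PadicInt.coe_add, PadicInt.coe_mul, PadicInt.coe_natCast]
  rw [div_eq_mul_inv, eq_inv_of_mul_eq_one_right h2]

end PadicDigits

section Matrices

variable {F : Type*} [Field F] {s : ℕ}

/-- Every row of every generating matrix has only finitely many nonzero entries. Rows are indexed
from `0`: the entry `c^{(i)}_{j,r}`, `j ≥ 1`, of the literature is `C i (j - 1) r`. -/
def FiniteRow (C : Fin s → ℕ → ℕ → F) : Prop :=
  ∀ i j, ∃ R, ∀ r, R ≤ r → C i j r = 0

/-- The matrix whose rows are the first `d i` rows of the `i`-th generating matrix for all `i`,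
each truncated to its first `m` entries. -/
def rowMatrix (C : Fin s → ℕ → ℕ → F) (d : Fin s → ℕ) (m : ℕ) :
    Matrix (Σ i : Fin s, Fin (d i)) (Fin m) F :=
  Matrix.of fun ij r => C ij.1 ij.2 r

/-- The matrices satisfy the rank condition with quality-parameter function `T`. -/
def HasQuality (C : Fin s → ℕ → ℕ → F) (T : ℕ → ℕ) : Prop :=
  ∀ m, T m < m → ∀ d : Fin s → ℕ, 1 ≤ ∑ i, d i → ∑ i, d i ≤ m - T m →
    (rowMatrix C d m).rank = ∑ i, d i

/-- The digital method driven by a sequence `σ` of `p ^ e`-adic integers: if `σ n` has the digits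
`a_0, a_1, …` in base `q = p ^ e`, then the `i`-th coordinate of the `n`-th point is
`∑_{j ≥ 1} lam_{i,j} (∑_r c^{(i)}_{j,r} ψ_r (a_r)) / q ^ j`. The inner sum has finitely many nonzero
terms when the matrices have finite rows. -/
noncomputable def digitalSequence (p : ℕ) [Fact p.Prime] (e : ℕ) (ψ : ℕ → Fin (p ^ e) ≃ F)
    (C : Fin s → ℕ → ℕ → F) (lam : Fin s → ℕ → F ≃ Fin (p ^ e)) (σ : ℕ → ℤ_[p]) :
    ℕ → Fin s → ℝ :=
  fun n i => ∑' j : ℕ,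
    ((lam i j (∑ᶠ r : ℕ, C i j r * ψ r (padicDigit p e (σ n) r)) : ℕ) : ℝ)
      / ((p ^ e : ℕ) : ℝ) ^ (j + 1)

end Matrices

section Discrepancy

variable {s : ℕ}

/-- The interval in `ℝ^s` with opposite vertices `0` and `u`; the `i`-th side is `[0, u i]` if
`closed i` and `[0, u i)` otherwise. -/
def originBox (u : Fin s → ℝ) (closed : Fin s → Bool) : Set (Fin s → ℝ) :=
  {y | ∀ i, 0 ≤ y i ∧ if closed i then y i ≤ u i else y i < u i}

open Classical in
/-- The number of indices `n < N` with `x n ∈ J`. -/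
noncomputable def countIn (J : Set (Fin s → ℝ)) (x : ℕ → Fin s → ℝ) (N : ℕ) : ℕ :=
  #{n ∈ range N | x n ∈ J}

/-- The star discrepancy of the first `N` terms of `x`: the supremum of `|A(J) / N - vol J|` over
all subintervals `J` of `[0,1]^s` with one vertex at the origin. -/
noncomputable def starDiscrepancy (x : ℕ → Fin s → ℝ) (N : ℕ) : ℝ :=
  sSup {δ : ℝ | ∃ (u : Fin s → ℝ) (closed : Fin s → Bool), (∀ i, 0 ≤ u i ∧ u i ≤ 1) ∧
    δ = |(countIn (originBox u closed) x N : ℝ) / N - ∏ i, u i|}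

/-- The supremum in the star discrepancy is over a set bounded by `1`. -/
theorem bddAbove_starDiscrepancy (x : ℕ → Fin s → ℝ) (N : ℕ) :
    BddAbove {δ : ℝ | ∃ (u : Fin s → ℝ) (closed : Fin s → Bool), (∀ i, 0 ≤ u i ∧ u i ≤ 1) ∧
      δ = |(countIn (originBox u closed) x N : ℝ) / N - ∏ i, u i|} := by
  classical
  refine ⟨1, ?_⟩
  rintro δ ⟨u, c, hu, rfl⟩
  have h1 : (countIn (originBox u c) x N : ℝ) ≤ N := by
    have : countIn (originBox u c) x N ≤ N := by
      simpa [countIn] using card_filter_le (range N) (fun n => x n ∈ originBox u c)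
    exact_mod_cast this
  have h2 : (countIn (originBox u c) x N : ℝ) / N ≤ 1 := div_le_one_of_le₀ h1 (by positivity)
  have h3 : 0 ≤ (countIn (originBox u c) x N : ℝ) / N := by positivity
  have h4 : ∏ i, u i ≤ 1 := prod_le_one (fun i _ => (hu i).1) (fun i _ => (hu i).2)
  have h5 : 0 ≤ ∏ i, u i := prod_nonneg (fun i _ => (hu i).1)
  rw [abs_le]
  constructor <;> linarith

/-- `N D_N^* ≤ c (log N)^s + O((log N)^(s-1))` for all `N ≥ 2`, with `c > 0` and the implied
constant independent of `N`. -/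
def IsLowDiscrepancy (x : ℕ → Fin s → ℝ) : Prop :=
  ∃ c : ℝ, 0 < c ∧ ∃ K : ℝ, ∀ N : ℕ, 2 ≤ N →
    (N : ℝ) * starDiscrepancy x N ≤ c * Real.log N ^ s + K * Real.log N ^ (s - 1)

end Discrepancy

end DigitalSeq

/-!
Write `q = p ^ e`, and let `vol J` be the volume of an origin box `J`. The proof bounds
`|∑_{n < N} (1_J (x_n) - vol J)|` by `c * (log N) ^ s`, uniformly in `J`.

*Reduction to blocks.* Splitting `n = v * k + ρ` gives `s_n = (ρ / v + α) + k`, so that the first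
`N` terms of `n / v + α` form `v` runs of consecutive `p`-adic integers (`fracShift_mul_add`). A
run of length at most `q ^ m` is the difference of two runs that start at a multiple of `q ^ m`,
and such a run is cut greedily into blocks `z, z + 1, …, z + q ^ l - 1` with `q ^ l ∣ z`, at most
`q` of them for each `l ≤ m` (`abs_sum_initial_run_le`). With `q ^ m` of the order of `N` there
are `O(log N)` blocks, and it remains to bound the error of one block by `O((log N) ^ (s - 1))`.

*Blocks are nets.* Along a block the digits of index at least `l` are constant and the lower ones
run through all of `{0, …, q - 1} ^ l`. Prescribing the first `d i` output digits in the `i`-th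
coordinate is an affine linear system over the field, which by the rank condition has exactly
`q ^ (l - ∑ i, d i)` solutions when `∑ i, d i ≤ l - t` (`isNet_block`).

*Discrepancy of a net.* `IsNet.abs_card_sub_le` is an induction on the number of coordinates. The
first side `[0, u)` is exhausted by elementary intervals of levels `1, …, L`, fewer than `q` of
each level, and over each of them the remaining coordinates form a net again; what is left lies in
a single elementary interval of level `L` and contains `O(1)` points. Each coordinate after the
first thus costs one factor `O(L)`.

The value of a digit expansion does not determine its digits, so everything is phrased through the
integers formed by the first `j` digits. Where the end point `u` of a side has two expansions, the
one not ending in digits `q - 1` is used for `[0, u]` and the one not ending in zeros for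
`[0, u)`, which makes the lexicographic comparison of digits decide membership unless all the
digits compared agree (`exists_isTruncation_cut`).
-/

namespace DigitalSeq

open Finset

/-! ### Truncated base-`q` expansions -/

/-- The natural number `a j` has the digits `d₀, …, d_{j-1}`, for some base-`q` expansion
`0.d₀d₁…` of `x ∈ [0, 1]`. Expansions ending in digits `q - 1` are allowed, so `a j` may be
`q ^ j * x - 1` instead of `⌊q ^ j * x⌋`. -/
structure IsTruncation (q : ℕ) (a : ℕ → ℕ) (x : ℝ) : Prop where
  zero : a 0 = 0
  div : ∀ j, a (j + 1) / q = a j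
  le : ∀ j, (a j : ℝ) ≤ (q : ℝ) ^ j * x
  le_add_one : ∀ j, (q : ℝ) ^ j * x ≤ a j + 1

namespace IsTruncation

variable {q : ℕ} {a b : ℕ → ℕ} {x u : ℝ}

theorem nonneg (h : IsTruncation q a x) : 0 ≤ x := by
  simpa [h.zero] using h.le 0

theorem mul_le (h : IsTruncation q a x) (j : ℕ) : q * a j ≤ a (j + 1) := by
  rw [← h.div j]; exact Nat.mul_div_le _ _

theorem lt_mul_add (h : IsTruncation q a x) (hq : 0 < q) (j : ℕ) :
    a (j + 1) < q * (a j + 1) := by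
  rw [← h.div j, mul_comm]; exact Nat.lt_mul_of_div_lt (Nat.lt_succ_self _) hq

theorem lt_pow (h : IsTruncation q a x) (hq : 0 < q) (j : ℕ) : a j < q ^ j := by
  induction j with
  | zero => simp [h.zero]
  | succ j ih =>
    calc a (j + 1) < q * (a j + 1) := h.lt_mul_add hq j
      _ ≤ q * q ^ j := Nat.mul_le_mul_left _ ih
      _ = q ^ (j + 1) := by ring

theorem lt_succ_iff (ha : IsTruncation q a x) (hb : IsTruncation q b u) (hq : 0 < q) (j : ℕ) :
    a (j + 1) < b (j + 1) ↔ a j < b j ∨ (q * b j ≤ a (j + 1) ∧ a (j + 1) < b (j + 1)) := by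
  have h1 := ha.lt_mul_add hq j
  have h2 := hb.mul_le j
  constructor
  · intro h
    by_cases h3 : q * b j ≤ a (j + 1)
    · exact Or.inr ⟨h3, h⟩
    · left
      have := ha.mul_le j
      exact Nat.lt_of_mul_lt_mul_left (a := q) (by omega)
  · rintro (h | h)
    · have : q * (a j + 1) ≤ q * b j := Nat.mul_le_mul_left _ h
      omega
    · exact h.2

end IsTruncation

/-- The end point `u` of a side `[0, u]` or `[0, u)` has an expansion such that comparing
truncations at any level decides membership in the side, except when the truncations agree. -/
theorem exists_isTruncation_cut {q : ℕ} (hq : 0 < q) {u : ℝ} (h0 : 0 ≤ u) (h1 : u ≤ 1)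
    (closed : Bool) :
    ∃ b, IsTruncation q b u ∧ ∀ a x, IsTruncation q a x → ∀ j,
      (a j < b j → if closed then x ≤ u else x < u) ∧
      (b j < a j → ¬ if closed then x ≤ u else x < u) := by
  have hq' : (0 : ℝ) < q := by exact_mod_cast hq
  have hpos : ∀ j, (0 : ℝ) < (q : ℝ) ^ j := fun j => by positivity
  have hle : ∀ {a x}, IsTruncation q a x → ∀ {j c}, a j < c → (q : ℝ) ^ j * x ≤ (c : ℕ) := by
    intro a x ha j c h
    have : (a j : ℝ) + 1 ≤ c := by exact_mod_cast h
    exact (ha.le_add_one j).trans this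
  have hge : ∀ {a x}, IsTruncation q a x → ∀ {j c}, c < a j →
      ((c : ℕ) : ℝ) + 1 ≤ (q : ℝ) ^ j * x := by
    intro a x ha j c h
    have : (c : ℝ) + 1 ≤ a j := by exact_mod_cast h
    exact this.trans (ha.le j)
  cases closed with
  | true =>
    rcases h1.lt_or_eq with h1 | rfl
    -- `[0, u]` with `u < 1`: the expansion of `u` not ending in digits `q - 1`
    · have hb : IsTruncation q (fun j => ⌊(q : ℝ) ^ j * u⌋₊) u := by
        refine ⟨?_, fun j => ?_, fun j => Nat.floor_le (by positivity),
          fun j => (Nat.lt_floor_add_one _).le⟩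
        · simpa using h1
        · rw [← Nat.floor_div_natCast]
          congr 1
          field_simp
          ring
      refine ⟨_, hb, fun a x ha j => ⟨fun h => ?_, fun h => ?_⟩⟩
      · have := (hle ha h).trans (hb.le j)
        simpa using le_of_mul_le_mul_left this (hpos j)
      · have := (Nat.lt_floor_add_one ((q : ℝ) ^ j * u)).trans_le (hge ha h)
        simpa using lt_of_mul_lt_mul_left this (hpos j).le
    -- `[0, 1]`: all digits are `q - 1`, and nothing lies above
    · have hc : ∀ j, ((q ^ j - 1 : ℕ) : ℝ) = (q : ℝ) ^ j - 1 := fun j => by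
        rw [Nat.cast_sub (Nat.one_le_pow _ _ hq)]; simp
      have hb : IsTruncation q (fun j => q ^ j - 1) 1 := by
        refine ⟨by simp, fun j => ?_, fun j => ?_, fun j => ?_⟩
        · have := Nat.one_le_pow j q hq
          rw [Nat.div_eq_iff hq]
          have h2 : q ^ (j + 1) = (q ^ j - 1) * q + q := by
            rw [← Nat.succ_mul, Nat.succ_eq_add_one, Nat.sub_add_cancel this, pow_succ]
          omega
        · simp only [hc]; linarith
        · simp only [hc]; linarith
      refine ⟨_, hb, fun a x ha j => ⟨fun _ => ?_, fun h => ?_⟩⟩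
      · have := ha.le_add_one 0
        simpa [ha.zero] using this
      · have := ha.lt_pow hq j
        omega
  | false =>
    rcases h0.lt_or_eq with h0 | rfl
    -- `[0, u)` with `0 < u`: the expansion of `u` not ending in zeros
    · have hcp : ∀ j, 0 < ⌈(q : ℝ) ^ j * u⌉₊ := fun j => Nat.ceil_pos.2 (by positivity)
      have hc : ∀ j, ((⌈(q : ℝ) ^ j * u⌉₊ - 1 : ℕ) : ℝ) = (⌈(q : ℝ) ^ j * u⌉₊ : ℝ) - 1 := by
        intro j
        rw [Nat.cast_sub (hcp j)]; simp
      have hlt : ∀ j, ((⌈(q : ℝ) ^ j * u⌉₊ - 1 : ℕ) : ℝ) < (q : ℝ) ^ j * u := fun j => by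
        have := Nat.ceil_lt_add_one (a := (q : ℝ) ^ j * u) (by positivity)
        rw [hc]; linarith
      have hb : IsTruncation q (fun j => ⌈(q : ℝ) ^ j * u⌉₊ - 1) u := by
        refine ⟨?_, fun j => ?_, fun j => (hlt j).le, fun j => ?_⟩
        · have : ⌈u⌉₊ ≤ 1 := by simpa using h1
          simp; omega
        · have e1 : ⌈(q : ℝ) ^ (j + 1) * u⌉₊ ≤ q * ⌈(q : ℝ) ^ j * u⌉₊ := by
            rw [Nat.ceil_le]
            push_cast
            calc (q : ℝ) ^ (j + 1) * u = q * ((q : ℝ) ^ j * u) := by ring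
              _ ≤ _ := by gcongr; exact Nat.le_ceil _
          have e2 : q * (⌈(q : ℝ) ^ j * u⌉₊ - 1) < ⌈(q : ℝ) ^ (j + 1) * u⌉₊ := by
            rw [Nat.lt_ceil, Nat.cast_mul]
            calc (q : ℝ) * ((⌈(q : ℝ) ^ j * u⌉₊ - 1 : ℕ) : ℝ) < q * ((q : ℝ) ^ j * u) := by
                  gcongr; exact hlt j
              _ = _ := by ring
          obtain ⟨c, hc⟩ : ∃ c, ⌈(q : ℝ) ^ j * u⌉₊ = c + 1 :=
            ⟨_, (Nat.sub_add_cancel (hcp j)).symm⟩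
          rw [hc] at e1 e2 ⊢
          rw [Nat.div_eq_iff hq]
          rw [mul_add] at e1
          simp only [Nat.add_sub_cancel, mul_comm c] at e2 ⊢
          omega
        · simp only [hc]; linarith [Nat.le_ceil ((q : ℝ) ^ j * u)]
      refine ⟨_, hb, fun a x ha j => ⟨fun h => ?_, fun h => ?_⟩⟩
      · have := (hle ha h).trans_lt (hlt j)
        simpa using lt_of_mul_lt_mul_left this (hpos j).le
      · have := (hb.le_add_one j).trans (hge ha h)
        simpa using le_of_mul_le_mul_left this (hpos j)
    -- `[0, 0)` is empty: all digits are `0`, and nothing lies below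
    · refine ⟨fun _ => 0, ⟨rfl, by simp, by simp, by simp⟩, fun a x ha j => ⟨by simp, fun _ => ?_⟩⟩
      simpa using ha.nonneg

/-- The natural number with base-`q` digits `D 0, …, D (j - 1)`, the most significant first. -/
def digitPrefix {q : ℕ} (D : ℕ → Fin q) : ℕ → ℕ
  | 0 => 0
  | j + 1 => digitPrefix D j * q + D j

theorem pow_mul_ofDigits {q : ℕ} (D : ℕ → Fin q) (j : ℕ) :
    (q : ℝ) ^ j * Real.ofDigits D = digitPrefix D j + Real.ofDigits (fun i => D (i + j)) := by
  have hq : (q : ℝ) ≠ 0 := by exact_mod_cast (Fin.pos (D 0)).ne'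
  have h : ∀ j, (q : ℝ) ^ j * ∑ i ∈ range j, Real.ofDigitsTerm D i = digitPrefix D j := by
    intro j
    induction j with
    | zero => simp [digitPrefix]
    | succ j ih =>
      rw [sum_range_succ, mul_add, pow_succ', mul_assoc, ih, digitPrefix, Real.ofDigitsTerm]
      push_cast
      field_simp
      ring
  rw [Real.ofDigits_eq_sum_add_ofDigits D j, mul_add, h, mul_inv_cancel_left₀ (pow_ne_zero j hq)]

theorem isTruncation_digitPrefix {q : ℕ} (D : ℕ → Fin q) :
    IsTruncation q (digitPrefix D) (Real.ofDigits D) where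
  zero := rfl
  div j := by
    rw [digitPrefix, mul_comm, Nat.mul_add_div (Fin.pos (D 0)), Nat.div_eq_of_lt (D j).2, add_zero]
  le j := by
    rw [pow_mul_ofDigits]
    linarith [Real.ofDigits_nonneg fun i => D (i + j)]
  le_add_one j := by
    rw [pow_mul_ofDigits]
    linarith [Real.ofDigits_le_one fun i => D (i + j)]

/-- Prescribing the number formed by the first `d` digits amounts to prescribing these digits. -/
theorem exists_forall_digitPrefix_eq_iff {q : ℕ} (hq : 0 < q) (d : ℕ) : ∀ c, c < q ^ d →
    ∃ w : Fin d → Fin q, ∀ D : ℕ → Fin q, digitPrefix D d = c ↔ ∀ j : Fin d, D j = w j := by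
  induction d with
  | zero =>
    intro c hc
    exact ⟨Fin.elim0, fun D => ⟨fun _ j => j.elim0, fun _ => by simp at hc; simp [hc, digitPrefix]⟩⟩
  | succ d ih =>
    intro c hc
    obtain ⟨w, hw⟩ := ih (c / q) (Nat.div_lt_of_lt_mul (by rwa [pow_succ'] at hc))
    refine ⟨Fin.snoc w ⟨c % q, Nat.mod_lt _ hq⟩, fun D => ?_⟩
    rw [Fin.forall_fin_succ', digitPrefix]
    simp only [Fin.val_castSucc, Fin.snoc_castSucc, Fin.val_last, Fin.snoc_last]
    rw [← hw, Fin.ext_iff]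
    constructor
    · rintro rfl
      constructor
      · rw [mul_comm, Nat.mul_add_div hq, Nat.div_eq_of_lt (D d).2, add_zero]
      · simp [Nat.mod_eq_of_lt (D d).2]
    · rintro ⟨h1, h2⟩
      simp only at h2
      rw [h1, h2, Nat.div_add_mod']

/-! ### Counting the points of a net in an origin box -/

/-- The points of `P`, given by the truncations `A n i` of their coordinates, form a net of
strength `L` and multiplicity `W`: each elementary interval with sides of length `q ^ (-d i)`,
`∑ i, d i ≤ L`, contains exactly `W * q ^ (L - ∑ i, d i)` of them. Membership is read off from the
truncations, not from the values of the coordinates. A `(t, m, s)`-net is the case `L = m - t`,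
`W = q ^ t`. -/
def IsNet {ι : Type*} {k : ℕ} (q L W : ℕ) (P : Finset ι) (A : ι → Fin k → ℕ → ℕ) : Prop :=
  ∀ d c : Fin k → ℕ, (∀ i, c i < q ^ d i) → ∑ i, d i ≤ L →
    #{n ∈ P | ∀ i, A n i (d i) = c i} = W * q ^ (L - ∑ i, d i)

/-- Fixing the first `j` digits of the first coordinate leaves a net in the other coordinates. -/
theorem IsNet.slice {ι : Type*} {k q L W : ℕ} {P : Finset ι} {A : ι → Fin (k + 1) → ℕ → ℕ}
    (h : IsNet q L W P A) {j c : ℕ} (hj : j ≤ L) (hc : c < q ^ j) :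
    IsNet q (L - j) W {n ∈ P | A n 0 j = c} (fun n i => A n i.succ) := by
  intro d' c' hc' hd'
  have := h (Fin.cons j d') (Fin.cons c c') (Fin.forall_fin_succ.2 ⟨by simpa, by simpa⟩)
    (by rw [Fin.sum_univ_succ]; simp; omega)
  rw [Fin.sum_univ_succ] at this
  simp only [Fin.forall_fin_succ, Fin.cons_zero, Fin.cons_succ] at this
  rw [filter_filter, this, Nat.sub_sub]

open Classical in
/-- The discrepancy of a net, with an explicit bound polynomial in the strength of degree one less
than the dimension. -/
theorem IsNet.abs_card_sub_le {ι : Type*} {q W : ℕ} (hq : 0 < q) : ∀ {k L : ℕ} {P : Finset ι}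
    {A : ι → Fin k → ℕ → ℕ} {x : ι → Fin k → ℝ}, IsNet q L W P A →
    (∀ n i, IsTruncation q (A n i) (x n i)) → ∀ (u : Fin k → ℝ) (closed : Fin k → Bool),
    (∀ i, 0 ≤ u i ∧ u i ≤ 1) →
    |(#{n ∈ P | x n ∈ originBox u closed} : ℝ) - W * (q : ℝ) ^ L * ∏ i, u i| ≤
      W * ∑ i ∈ range k, ((q : ℝ) * L + 1) ^ i := by
  have hq' : (0 : ℝ) < q := by exact_mod_cast hq
  intro k
  induction k with
  | zero =>
    intro L P A x hP hA u closed hu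
    have := hP Fin.elim0 Fin.elim0 (fun i => i.elim0) (by simp)
    simp only [IsEmpty.forall_iff, filter_true, univ_eq_empty, sum_empty, Nat.sub_zero] at this
    simp [originBox, this]
  | succ k ih =>
    intro L P A x hP hA u closed hu
    set u' : Fin k → ℝ := fun i => u i.succ with hu'
    set V : ℝ := ∏ i, u' i with hV
    set Q : ι → Prop := fun n => (fun i => x n i.succ) ∈ originBox u' (fun i => closed i.succ)
      with hQ
    set S : ℝ := ∑ i ∈ range k, ((q : ℝ) * L + 1) ^ i with hS
    have hS0 : 0 ≤ S := by positivity
    have hV0 : 0 ≤ V := prod_nonneg fun i _ => (hu _).1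
    have hV1 : V ≤ 1 := prod_le_one (fun i _ => (hu _).1) fun i _ => (hu _).2
    obtain ⟨b, hb, hcut⟩ := exists_isTruncation_cut hq (hu 0).1 (hu 0).2 (closed 0)
    -- by induction, the error over one elementary interval of level `j` in the first coordinate
    have hslice : ∀ j ≤ L, ∀ c < q ^ j, |(#{n ∈ P | A n 0 j = c ∧ Q n} : ℝ)
        - W * (q : ℝ) ^ (L - j) * V| ≤ W * S := by
      intro j hj c hc
      have h := ih (hP.slice hj hc) (fun n i => hA n i.succ) u' (fun i => closed i.succ)
        (fun i => hu i.succ)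
      rw [filter_filter] at h
      refine h.trans ?_
      rw [hS]
      gcongr
      exact Nat.sub_le _ _
    -- the part of the side exhausted by elementary intervals of levels `1, …, j`
    have hmain : ∀ j ≤ L, |(#{n ∈ P | A n 0 j < b j ∧ Q n} : ℝ)
        - W * (q : ℝ) ^ (L - j) * b j * V| ≤ j * q * (W * S) := by
      intro j
      induction j with
      | zero => intro _; simp [hb.zero]
      | succ j ihj =>
        intro hj
        -- level `j + 1` adds the children of the interval `b j` that precede the child `b (j + 1)`
        have hsplit : #{n ∈ P | A n 0 (j + 1) < b (j + 1) ∧ Q n} =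
            #{n ∈ P | A n 0 j < b j ∧ Q n} +
              ∑ c ∈ Ico (q * b j) (b (j + 1)), #{n ∈ P | A n 0 (j + 1) = c ∧ Q n} := by
          rw [← card_biUnion, ← card_union_of_disjoint]
          · congr 1
            ext n
            simp only [mem_filter, mem_union, mem_biUnion, mem_Ico]
            rw [(hA n 0).lt_succ_iff hb hq]
            constructor
            · rintro ⟨h1, h2 | h2, h3⟩
              · exact Or.inl ⟨h1, h2, h3⟩
              · exact Or.inr ⟨_, h2, h1, rfl, h3⟩
            · rintro (⟨h1, h2, h3⟩ | ⟨c, h2, h1, rfl, h3⟩)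
              · exact ⟨h1, Or.inl h2, h3⟩
              · exact ⟨h1, Or.inr h2, h3⟩
          · rw [disjoint_left]
            simp only [mem_filter, mem_biUnion, mem_Ico]
            rintro n ⟨h1, h2, h3⟩ ⟨c, h4, -, rfl, -⟩
            have h5 := (hA n 0).lt_mul_add hq j
            have h6 : q * (A n 0 j + 1) ≤ q * b j := Nat.mul_le_mul_left _ h2
            omega
          · intro c _ c' _ hcc
            rw [Function.onFun, disjoint_left]
            simp only [mem_filter]
            rintro n ⟨_, h2, _⟩ ⟨_, h3, _⟩
            exact hcc (h2.symm.trans h3)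
        have hcard : ((b (j + 1) - q * b j : ℕ) : ℝ) = b (j + 1) - q * b j := by
          rw [Nat.cast_sub (hb.mul_le j)]; simp
        have hpow : (q : ℝ) ^ (L - j) = q ^ (L - (j + 1)) * q := by
          rw [← pow_succ]; congr 1; omega
        have hnew : |∑ c ∈ Ico (q * b j) (b (j + 1)), ((#{n ∈ P | A n 0 (j + 1) = c ∧ Q n} : ℝ)
            - W * (q : ℝ) ^ (L - (j + 1)) * V)| ≤ q * (W * S) := by
          refine (abs_sum_le_sum_abs _ _).trans ?_
          refine (sum_le_card_nsmul _ _ (W * S) fun c hc => ?_).trans ?_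
          · exact hslice _ hj c ((mem_Ico.1 hc).2.trans (hb.lt_pow hq _))
          · rw [Nat.card_Ico, nsmul_eq_mul]
            have := hb.lt_mul_add hq j
            rw [mul_add] at this
            gcongr
            omega
        rw [sum_sub_distrib, sum_const, Nat.card_Ico, nsmul_eq_mul, hcard] at hnew
        have hold := ihj (by omega)
        rw [hsplit]
        push_cast
        rw [hpow] at hold
        calc _ = |_ + _| := by congr 1; ring
          _ ≤ _ := abs_add_le _ _
          _ ≤ _ := add_le_add hold hnew
          _ = _ := by ring
    have hL := hmain L le_rfl
    simp only [Nat.sub_self, pow_zero, mul_one] at hL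
    have hbox : ∀ n, x n ∈ originBox u closed ↔
        (if closed 0 then x n 0 ≤ u 0 else x n 0 < u 0) ∧ Q n := by
      intro n
      simp only [originBox, hQ, Set.mem_ofPred_eq, Fin.forall_fin_succ, (hA n 0).nonneg,
        hu', true_and]
    have hlow : #{n ∈ P | A n 0 L < b L ∧ Q n} ≤ #{n ∈ P | x n ∈ originBox u closed} := by
      refine card_le_card (monotone_filter_right _ fun n _ hn => ?_)
      exact (hbox n).2 ⟨(hcut _ _ (hA n 0) L).1 hn.1, hn.2⟩
    -- the rest of the side lies in the last interval of level `L`, which holds `W` points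
    have hrest : #{n ∈ P | A n 0 L = b L} = W := by
      have := hP.slice le_rfl (hb.lt_pow hq L) (fun _ => 0) (fun _ => 0) (by simp) (by simp)
      have h0 : ∀ n, ∀ i : Fin k, A n i.succ 0 = 0 := fun n i => (hA n i.succ).zero
      simpa only [h0, filter_true, implies_true, and_true, sum_const_zero,
        Nat.sub_self, pow_zero, mul_one] using this
    have hupp : #{n ∈ P | x n ∈ originBox u closed} ≤ #{n ∈ P | A n 0 L < b L ∧ Q n} + W := by
      rw [← hrest]
      refine (card_le_card fun n hn => ?_).trans (card_union_le _ _)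
      simp only [mem_union, mem_filter] at hn ⊢
      have h1 := (hbox n).1 hn.2
      rcases lt_trichotomy (A n 0 L) (b L) with h | h | h
      · exact Or.inl ⟨hn.1, h, h1.2⟩
      · exact Or.inr ⟨hn.1, h⟩
      · exact absurd h1.1 ((hcut _ _ (hA n 0) L).2 h)
    have hlow' : (#{n ∈ P | A n 0 L < b L ∧ Q n} : ℝ) ≤ #{n ∈ P | x n ∈ originBox u closed} := by
      exact_mod_cast hlow
    have hupp' : (#{n ∈ P | x n ∈ originBox u closed} : ℝ) ≤
        #{n ∈ P | A n 0 L < b L ∧ Q n} + W := by exact_mod_cast hupp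
    have hW : (0 : ℝ) ≤ W := by positivity
    have hv1 : (W : ℝ) * b L * V ≤ W * (q : ℝ) ^ L * (u 0 * V) := by
      have := mul_le_mul_of_nonneg_left (hb.le L) (mul_nonneg hW hV0)
      linarith
    have hv2 : (W : ℝ) * (q : ℝ) ^ L * (u 0 * V) ≤ W * b L * V + W := by
      have := mul_le_mul_of_nonneg_left (hb.le_add_one L) (mul_nonneg hW hV0)
      have := mul_le_mul_of_nonneg_left hV1 hW
      linarith
    have hgeom : ∑ i ∈ range (k + 1), ((q : ℝ) * L + 1) ^ i = ((q : ℝ) * L + 1) * S + 1 := by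
      rw [sum_range_succ', hS, mul_sum]; simp [pow_succ']
    rw [Fin.prod_univ_succ, hgeom]
    have hWS : 0 ≤ W * S := mul_nonneg hW hS0
    change |_ - (W : ℝ) * (q : ℝ) ^ L * (u 0 * V)| ≤ _
    rw [abs_le] at hL ⊢
    constructor <;> nlinarith

/-! ### Digits of a `p`-adic integer along a block -/

section Padic

variable {p : ℕ} [hp : Fact p.Prime]

theorem appr_eq_of_dvd {x : ℤ_[p]} {n a : ℕ} (ha : a < p ^ n) (h : (p : ℤ_[p]) ^ n ∣ x - a) :
    x.appr n = a := by
  have h1 := (Ideal.mem_span_singleton.1 (x.appr_spec n))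
  have h2 : (p : ℤ_[p]) ^ n ∣ ((x.appr n : ℤ) - (a : ℤ) : ℤ) := by
    have := dvd_sub h h1
    push_cast
    convert this using 1
    ring
  have h3 : ((p ^ n : ℕ) : ℤ) ∣ (x.appr n : ℤ) - a := by
    have h4 := PadicInt.norm_int_le_pow_iff_dvd.1
      ((PadicInt.norm_le_pow_iff_mem_span_pow _ _).2 (Ideal.mem_span_singleton.2 h2))
    exact_mod_cast h4
  have h5 : a ≡ x.appr n [MOD p ^ n] := (Nat.modEq_iff_dvd).2 h3
  have := x.appr_lt n
  rw [Nat.ModEq, Nat.mod_eq_of_lt ha, Nat.mod_eq_of_lt this] at h5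
  exact h5.symm

variable {e l : ℕ}

/-- The digits below `l` along a block starting at a multiple of `q ^ l`. -/
theorem padicDigit_add_of_lt {z : ℤ_[p]} (hz : (p : ℤ_[p]) ^ (e * l) ∣ z) (r : ℕ)
    {k : ℕ} (hk : k < l) :
    (padicDigit p e (z + r) k : ℕ) = r / (p ^ e) ^ k % p ^ e := by
  have h : (z + r).appr (e * (k + 1)) = r % p ^ (e * (k + 1)) := by
    refine appr_eq_of_dvd (Nat.mod_lt _ (pow_pos hp.out.pos _)) ?_
    have h1 : (p : ℤ_[p]) ^ (e * (k + 1)) ∣ z :=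
      (pow_dvd_pow _ (Nat.mul_le_mul_left e hk)).trans hz
    have h2 : (r : ℤ_[p]) = (p : ℤ_[p]) ^ (e * (k + 1)) * (r / p ^ (e * (k + 1)) : ℕ)
        + (r % p ^ (e * (k + 1)) : ℕ) := by
      exact_mod_cast (Nat.div_add_mod r (p ^ (e * (k + 1)))).symm
    rw [h2]
    simpa [add_sub_assoc] using dvd_add h1 (Dvd.intro _ rfl)
  simp only [padicDigit, h]
  rw [pow_mul, pow_succ, Nat.mod_mul_right_div_self]

/-- The digits from `l` on are constant along a block starting at a multiple of `q ^ l`. -/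
theorem padicDigit_add_of_le {z : ℤ_[p]} (hz : (p : ℤ_[p]) ^ (e * l) ∣ z) {r : ℕ}
    (hr : r < (p ^ e) ^ l) {k : ℕ} (hk : l ≤ k) :
    padicDigit p e (z + r) k = padicDigit p e z k := by
  set n := e * (k + 1) with hn
  have hln : e * l ≤ n := Nat.mul_le_mul_left e (by omega)
  have hdvd : p ^ (e * l) ∣ z.appr n := by
    have h0 : z.appr (e * l) = 0 := appr_eq_of_dvd (pow_pos hp.out.pos _) (by simpa using hz)
    simpa [h0] using z.dvd_appr_sub_appr _ _ hln
  rw [← pow_mul] at hr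
  have hlt : z.appr n + r < p ^ n := by
    obtain ⟨c, hc⟩ := hdvd
    obtain ⟨m, hm⟩ := pow_dvd_pow p hln
    have h1 := z.appr_lt n
    rw [hc, hm] at h1 ⊢
    have h2 := Nat.lt_of_mul_lt_mul_left h1
    calc _ < p ^ (e * l) * c + p ^ (e * l) := by omega
      _ = p ^ (e * l) * (c + 1) := by ring
      _ ≤ _ := Nat.mul_le_mul_left _ h2
  have h : (z + r).appr n = z.appr n + r := by
    refine appr_eq_of_dvd hlt ?_
    have := Ideal.mem_span_singleton.1 (z.appr_spec n)
    push_cast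
    convert this using 1
    ring
  simp only [padicDigit, Fin.mk.injEq, ← hn, h]
  obtain ⟨k', rfl⟩ := Nat.exists_eq_add_of_le hk
  obtain ⟨c, hc⟩ := hdvd
  rw [pow_add, ← pow_mul, ← Nat.div_div_eq_div_mul, ← Nat.div_div_eq_div_mul, hc,
    Nat.mul_add_div (pow_pos hp.out.pos _), Nat.div_eq_of_lt hr,
    Nat.mul_div_cancel_left _ (pow_pos hp.out.pos _), add_zero]

end Padic

/-! ### Blocks of the digital sequence are nets -/

/-- A linear system whose matrix has full row rank has the expected number of solutions. -/
theorem card_mulVec_eq {F ι κ : Type*} [Field F] [Fintype F] [Fintype ι] [Fintype κ]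
    [DecidableEq F] [DecidableEq ι] [DecidableEq κ] (M : Matrix ι κ F)
    (hM : M.rank = Fintype.card ι) (b : ι → F) :
    #{x : κ → F | M.mulVec x = b} = Fintype.card F ^ (Fintype.card κ - Fintype.card ι) := by
  have hsurj : Function.Surjective M.mulVecLin := by
    rw [← LinearMap.range_eq_top]
    apply Submodule.eq_top_of_finrank_eq
    rw [← Matrix.rank, hM, Module.finrank_fintype_fun_eq_card]
  -- all fibres are translates of each other
  have hfib : ∀ b', #{x : κ → F | M.mulVec x = b'} = #{x : κ → F | M.mulVec x = b} := by
    intro b'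
    obtain ⟨y, hy⟩ := hsurj b'
    obtain ⟨y', hy'⟩ := hsurj b
    simp only [Matrix.mulVecLin_apply] at hy hy'
    refine card_bij' (fun x _ => x - y + y') (fun x _ => x - y' + y) ?_ ?_ ?_ ?_ <;>
      simp +contextual [Matrix.mulVec_add, Matrix.mulVec_sub, hy, hy']
  have hsum := card_eq_sum_card_fiberwise (s := (univ : Finset (κ → F))) (t := univ)
    (f := fun x => M.mulVec x) (fun _ _ => by simp)
  simp only [hfib, sum_const, card_univ, Fintype.card_fun, smul_eq_mul] at hsum
  have hle : Fintype.card ι ≤ Fintype.card κ := hM ▸ M.rank_le_card_width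
  rw [← Nat.sub_add_cancel hle, pow_add, mul_comm] at hsum
  exact (Nat.eq_of_mul_eq_mul_left (pow_pos Fintype.card_pos _) hsum).symm

section Block

variable {p : ℕ} [hp : Fact p.Prime] {e s : ℕ} {F : Type*} [Field F]

/-- The digit with index `j` (from `0`) of the `i`-th coordinate of the point that the digital
method assigns to `z : ℤ_[p]`. -/
noncomputable def outputDigit (p : ℕ) [Fact p.Prime] (e : ℕ) (ψ : ℕ → Fin (p ^ e) ≃ F)
    (C : Fin s → ℕ → ℕ → F) (lam : Fin s → ℕ → F ≃ Fin (p ^ e)) (z : ℤ_[p]) (i : Fin s) (j : ℕ) :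
    Fin (p ^ e) :=
  lam i j (∑ᶠ r : ℕ, C i j r * ψ r (padicDigit p e z r))

variable {ψ : ℕ → Fin (p ^ e) ≃ F} {C : Fin s → ℕ → ℕ → F} {lam : Fin s → ℕ → F ≃ Fin (p ^ e)}

theorem digitalSequence_eq_ofDigits (σ : ℕ → ℤ_[p]) (n : ℕ) :
    digitalSequence p e ψ C lam σ n =
      fun i => Real.ofDigits (outputDigit p e ψ C lam (σ n) i) := by
  funext i
  simp [digitalSequence, Real.ofDigits, Real.ofDigitsTerm, outputDigit, div_eq_mul_inv]

/-- Along a block the argument of the output bijection is a linear form in the `l` lowest digits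
plus a constant: the contribution of the higher digits does not change. -/
theorem exists_finsum_eq_sum_add (hfin : FiniteRow C) {l : ℕ} {z : ℤ_[p]}
    (hz : (p : ℤ_[p]) ^ (e * l) ∣ z) (i : Fin s) (j : ℕ) :
    ∃ τ : F, ∀ r < (p ^ e) ^ l,
      ∑ᶠ k : ℕ, C i j k * ψ k (padicDigit p e (z + (r : ℕ)) k) =
        ∑ k : Fin l, C i j k * ψ k (padicDigit p e (z + (r : ℕ)) k) + τ := by
  obtain ⟨R, hR⟩ := hfin i j
  refine ⟨∑ k ∈ range R, C i j (l + k) * ψ (l + k) (padicDigit p e z (l + k)), fun r hr => ?_⟩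
  rw [finsum_eq_sum_of_support_subset (s := range (l + R)), sum_range_add, sum_range]
  · congr 1
    refine sum_congr rfl fun k _ => ?_
    rw [padicDigit_add_of_le hz hr (Nat.le_add_right l k)]
  · intro k hk
    rw [coe_range, Set.mem_Iio]
    by_contra h
    exact hk (by simp only [hR k (by omega), zero_mul])

/-- The block of length `q ^ l` starting at a multiple of `q ^ l` is mapped to a net. The
truncated subtraction covers `l < t`, where the net has strength `0` and multiplicity `q ^ l`. -/
theorem isNet_block [Fintype F] (hF : Fintype.card F = p ^ e) (hfin : FiniteRow C) {t : ℕ}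
    (hC : HasQuality C fun _ => t) {l : ℕ} {z : ℤ_[p]} (hz : (p : ℤ_[p]) ^ (e * l) ∣ z) :
    IsNet (p ^ e) (l - t) ((p ^ e) ^ (l - (l - t))) (range ((p ^ e) ^ l))
      (fun r i => digitPrefix (outputDigit p e ψ C lam (z + (r : ℕ)) i)) := by
  classical
  have hq : 0 < p ^ e := pow_pos hp.out.pos e
  intro d c hc hd
  choose w hw using fun i => exists_forall_digitPrefix_eq_iff hq (d i) (c i) (hc i)
  choose τ hτ using fun i j => exists_finsum_eq_sum_add (ψ := ψ) hfin hz i j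
  have hcard : Fintype.card (Σ i : Fin s, Fin (d i)) = ∑ i, d i := by simp
  have hrank : (rowMatrix C d l).rank = Fintype.card (Σ i : Fin s, Fin (d i)) := by
    rw [hcard]
    rcases Nat.eq_zero_or_pos (∑ i, d i) with h0 | h0
    · have := (rowMatrix C d l).rank_le_card_height
      omega
    · exact hC l (by simp only; omega) d h0 hd
  let b : (Σ i : Fin s, Fin (d i)) → F := fun ij =>
    (lam ij.1 ij.2).symm (w ij.1 ij.2) - τ ij.1 ij.2
  -- the index within the block, replaced by its digits mapped to the field
  let E : Fin ((p ^ e) ^ l) ≃ (Fin l → F) :=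
    finFunctionFinEquiv.symm.trans (Equiv.piCongrRight fun k => ψ k)
  have hE : ∀ (r : Fin ((p ^ e) ^ l)) (k : Fin l),
      E r k = ψ k (padicDigit p e (z + (r : ℕ)) k) := by
    intro r k
    simp only [E, Equiv.trans_apply, Equiv.piCongrRight_apply, Pi.map_apply]
    congr 1
    ext
    rw [padicDigit_add_of_lt hz r k.2]
    rfl
  have hiff : ∀ r : Fin ((p ^ e) ^ l),
      (∀ i, digitPrefix (outputDigit p e ψ C lam (z + (r : ℕ)) i) (d i) = c i) ↔
        (rowMatrix C d l).mulVec (E r) = b := by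
    intro r
    rw [funext_iff, Sigma.forall]
    refine forall_congr' fun i => (hw i _).trans (forall_congr' fun j => ?_)
    rw [outputDigit, hτ i j r r.2, ← Equiv.eq_symm_apply, ← eq_sub_iff_add_eq]
    simp only [Matrix.mulVec, dotProduct, rowMatrix, Matrix.of_apply, hE, b]
  have hcount := card_mulVec_eq (rowMatrix C d l) hrank b
  rw [hF, Fintype.card_fin, hcard] at hcount
  rw [← pow_add, show l - (l - t) + (l - t - ∑ i, d i) = l - ∑ i, d i by omega, ← hcount]
  symm
  refine card_bij (fun y _ => (E.symm y : ℕ)) (fun y hy => ?_) (fun y _ y' _ h => ?_)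
    (fun r hr => ?_)
  · simp only [mem_filter, mem_univ, true_and, mem_range] at hy ⊢
    exact ⟨(E.symm y).2, (hiff _).2 (by rwa [E.apply_symm_apply])⟩
  · exact E.symm.injective (Fin.ext h)
  · simp only [mem_filter, mem_range] at hr
    exact ⟨E ⟨r, hr.1⟩, by simpa using (hiff ⟨r, hr.1⟩).1 hr.2, by simp⟩

open Classical in
/-- The error of a single block, uniformly in the blocks of level at most `m`. -/
theorem abs_sum_block_le [Fintype F] (hF : Fintype.card F = p ^ e) (hfin : FiniteRow C) {t : ℕ}
    (hC : HasQuality C fun _ => t) {u : Fin s → ℝ} (closed : Fin s → Bool)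
    (hu : ∀ i, 0 ≤ u i ∧ u i ≤ 1) {m l : ℕ} (hl : l ≤ m) {z : ℤ_[p]}
    (hz : (p : ℤ_[p]) ^ (e * l) ∣ z) :
    |∑ r ∈ range ((p ^ e) ^ l),
      ((if (fun i => Real.ofDigits (outputDigit p e ψ C lam (z + (r : ℕ)) i)) ∈
        originBox u closed then (1 : ℝ) else 0) - ∏ i, u i)| ≤
      ((p ^ e : ℕ) : ℝ) ^ t * (s * (((p ^ e : ℕ) : ℝ) * m + 1) ^ (s - 1)) := by
  have hq : 0 < p ^ e := pow_pos hp.out.pos e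
  have hq1 : (1 : ℝ) ≤ ((p ^ e : ℕ) : ℝ) := by exact_mod_cast hq
  have h := (isNet_block (ψ := ψ) (lam := lam) hF hfin hC hz).abs_card_sub_le hq
    (fun r i => isTruncation_digitPrefix _) u closed hu
  rw [sum_sub_distrib, sum_boole, sum_const, card_range, nsmul_eq_mul]
  have hpow : (((p ^ e) ^ (l - (l - t)) : ℕ) : ℝ) * ((p ^ e : ℕ) : ℝ) ^ (l - t) =
      (((p ^ e) ^ l : ℕ) : ℝ) := by
    rw [Nat.cast_pow (p ^ e) (l - (l - t)), Nat.cast_pow (p ^ e) l, ← pow_add]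
    congr 1
    omega
  rw [hpow] at h
  refine h.trans (mul_le_mul ?_ ?_ (by positivity) (by positivity))
  · rw [Nat.cast_pow (p ^ e)]
    exact pow_le_pow_right₀ hq1 (by omega)
  · have hx : ((p ^ e : ℕ) : ℝ) * (l - t : ℕ) + 1 ≤ ((p ^ e : ℕ) : ℝ) * m + 1 := by
      gcongr
      omega
    have h1 : (1 : ℝ) ≤ ((p ^ e : ℕ) : ℝ) * m + 1 := by
      have : (0 : ℝ) ≤ ((p ^ e : ℕ) : ℝ) * m := by positivity
      linarith
    refine (sum_le_card_nsmul _ _ _ fun i hi => ?_).trans_eq (by rw [card_range, nsmul_eq_mul])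
    refine (pow_le_pow_left₀ (by positivity) hx i).trans (pow_le_pow_right₀ h1 ?_)
    have := mem_range.1 hi
    omega

end Block

/-! ### Runs of consecutive `p`-adic integers -/

section Runs

variable {p : ℕ} [hp : Fact p.Prime] {e : ℕ}

theorem abs_sum_blocks_le {f : ℤ_[p] → ℝ} {B : ℝ} {l : ℕ}
    (hf : ∀ z, (p : ℤ_[p]) ^ (e * l) ∣ z → |∑ r ∈ range ((p ^ e) ^ l), f (z + (r : ℕ))| ≤ B)
    {z : ℤ_[p]} (hz : (p : ℤ_[p]) ^ (e * l) ∣ z) (c : ℕ) :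
    |∑ r ∈ range (c * (p ^ e) ^ l), f (z + (r : ℕ))| ≤ c * B := by
  induction c with
  | zero => simp
  | succ c ih =>
    rw [add_mul, one_mul, sum_range_add]
    have h := hf (z + (c * (p ^ e) ^ l : ℕ)) (dvd_add hz (by rw [← pow_mul]; simp))
    calc _ ≤ _ := abs_add_le _ _
      _ ≤ c * B + B := add_le_add ih (by simpa [add_assoc] using h)
      _ = _ := by push_cast; ring

/-- A run from a multiple of `q ^ m` is cut greedily into blocks, the longest first. -/
theorem abs_sum_initial_run_le {f : ℤ_[p] → ℝ} {B : ℝ} (hB : 0 ≤ B) (m : ℕ)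
    (hf : ∀ l ≤ m, ∀ z, (p : ℤ_[p]) ^ (e * l) ∣ z →
      |∑ r ∈ range ((p ^ e) ^ l), f (z + (r : ℕ))| ≤ B)
    {z : ℤ_[p]} (hz : (p : ℤ_[p]) ^ (e * m) ∣ z) {b : ℕ} (hb : b < (p ^ e) ^ (m + 1)) :
    |∑ r ∈ range b, f (z + (r : ℕ))| ≤ (m + 1) * (p ^ e : ℕ) * B := by
  induction m generalizing z b with
  | zero =>
    have := abs_sum_blocks_le (hf 0 le_rfl) hz b
    simp only [pow_zero, mul_one] at this
    refine this.trans ?_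
    have hb' : b ≤ p ^ e := by simpa using hb.le
    have : (b : ℝ) ≤ (p ^ e : ℕ) := by exact_mod_cast hb'
    simpa using mul_le_mul_of_nonneg_right this hB
  | succ m ih =>
    have hQ : 0 < (p ^ e) ^ (m + 1) := pow_pos (pow_pos hp.out.pos e) _
    have hc : b / (p ^ e) ^ (m + 1) ≤ p ^ e :=
      (Nat.div_lt_of_lt_mul (by rwa [pow_succ _ (m + 1)] at hb)).le
    have h1 := abs_sum_blocks_le (hf _ le_rfl) hz (b / (p ^ e) ^ (m + 1))
    have hz' : (p : ℤ_[p]) ^ (e * m) ∣ z + (b / (p ^ e) ^ (m + 1) * (p ^ e) ^ (m + 1) : ℕ) := by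
      refine (pow_dvd_pow _ (Nat.mul_le_mul_left e m.le_succ)).trans (dvd_add hz ?_)
      rw [← pow_mul, Nat.cast_mul, Nat.cast_pow p]
      exact dvd_mul_left _ _
    have h2 := ih (fun l hl => hf l (by omega)) hz' (Nat.mod_lt b hQ)
    have hsplit : ∑ r ∈ range b, f (z + (r : ℕ)) =
        ∑ r ∈ range (b / (p ^ e) ^ (m + 1) * (p ^ e) ^ (m + 1)), f (z + (r : ℕ)) +
        ∑ r ∈ range (b % (p ^ e) ^ (m + 1)),
          f (z + (b / (p ^ e) ^ (m + 1) * (p ^ e) ^ (m + 1) : ℕ) + (r : ℕ)) := by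
      conv_lhs => rw [← Nat.div_add_mod' b ((p ^ e) ^ (m + 1)), sum_range_add]
      congr 1
      refine sum_congr rfl fun r _ => ?_
      rw [add_assoc, ← Nat.cast_add]
    have hc' : ((b / (p ^ e) ^ (m + 1) : ℕ) : ℝ) ≤ (p ^ e : ℕ) := by exact_mod_cast hc
    rw [hsplit]
    calc _ ≤ _ := abs_add_le _ _
      _ ≤ (p ^ e : ℕ) * B + (m + 1) * (p ^ e : ℕ) * B :=
        add_le_add (h1.trans (mul_le_mul_of_nonneg_right hc' hB)) h2
      _ = _ := by push_cast; ring

/-- An arbitrary run is the difference of two runs that start at `z` minus its residue modulo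
`q ^ m`, a multiple of `q ^ m`; both are shorter than `2 * q ^ m ≤ q ^ (m + 1)`. -/
theorem abs_sum_run_le (he : 1 ≤ e) {f : ℤ_[p] → ℝ} {B : ℝ} (hB : 0 ≤ B) (m : ℕ)
    (hf : ∀ l ≤ m, ∀ z, (p : ℤ_[p]) ^ (e * l) ∣ z →
      |∑ r ∈ range ((p ^ e) ^ l), f (z + (r : ℕ))| ≤ B)
    (z : ℤ_[p]) {M : ℕ} (hM : M ≤ (p ^ e) ^ m) :
    |∑ r ∈ range M, f (z + (r : ℕ))| ≤ 2 * ((m + 1) * (p ^ e : ℕ) * B) := by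
  have hq : 2 ≤ p ^ e := hp.out.two_le.trans (Nat.le_self_pow (by omega) p)
  set a := z.appr (e * m) with ha
  have hz : (p : ℤ_[p]) ^ (e * m) ∣ z - a := Ideal.mem_span_singleton.1 (z.appr_spec _)
  have halt : a < (p ^ e) ^ m := by rw [← pow_mul]; exact z.appr_lt _
  have h2 : 2 * (p ^ e) ^ m ≤ (p ^ e) ^ (m + 1) := by
    rw [pow_succ']; exact Nat.mul_le_mul_right _ hq
  have hA := abs_sum_initial_run_le hB m hf hz (b := a) (by omega)
  have hAM := abs_sum_initial_run_le hB m hf hz (b := a + M) (by omega)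
  rw [sum_range_add] at hAM
  have : ∑ r ∈ range M, f (z - a + ((a + r : ℕ) : ℤ_[p])) = ∑ r ∈ range M, f (z + (r : ℕ)) :=
    sum_congr rfl fun r _ => by push_cast; congr 1; ring
  rw [this] at hAM
  rw [abs_le] at *
  constructor <;> linarith

/-- Splitting a sum by residues modulo `v`. There are `⌈(N - ρ) / v⌉` indices `k` with
`v * k + ρ < N`; the numerator is arranged so that no subtraction truncates. -/
theorem sum_range_eq_sum_residues {v : ℕ} (hv : 0 < v) (N : ℕ) (g : ℕ → ℝ) :
    ∑ n ∈ range N, g n =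
      ∑ ρ ∈ range v, ∑ k ∈ range ((N + v - 1 - ρ) / v), g (v * k + ρ) := by
  rw [← sum_fiberwise_of_maps_to (t := range v) (g := fun n => n % v)
    (fun n _ => mem_range.2 (Nat.mod_lt n hv))]
  refine sum_congr rfl fun ρ hρ => ?_
  have hρ := mem_range.1 hρ
  have hiff : ∀ k, k < (N + v - 1 - ρ) / v ↔ v * k + ρ < N := by
    intro k
    rw [← Nat.succ_le_iff, Nat.le_div_iff_mul_le hv, Nat.succ_mul, mul_comm k]
    omega
  symm
  refine sum_nbij' (fun k => v * k + ρ) (fun n => n / v) ?_ ?_ ?_ ?_ (fun _ _ => rfl)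
  · intro k hk
    simp only [mem_filter, mem_range] at hk ⊢
    exact ⟨(hiff k).1 hk, by rw [Nat.mul_add_mod, Nat.mod_eq_of_lt hρ]⟩
  · intro n hn
    simp only [mem_filter, mem_range] at hn ⊢
    rw [hiff, ← hn.2, Nat.div_add_mod]
    exact hn.1
  · intro k _
    rw [Nat.mul_add_div hv, Nat.div_eq_of_lt hρ, add_zero]
  · intro n hn
    simp only [mem_filter, mem_range] at hn ⊢
    rw [← hn.2, Nat.div_add_mod]

theorem fracShift_mul_add {v : ℕ} (hv : v.Coprime (p ^ e)) (he : 1 ≤ e) (α : ℤ_[p]) (k ρ : ℕ) :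
    fracShift p v α (v * k + ρ) = fracShift p v α ρ + (k : ℕ) := by
  have hn : ‖(v : ℤ_[p])‖ = 1 := by
    rw [PadicInt.norm_natCast_eq_one_iff]
    exact (Nat.Coprime.coprime_dvd_right (dvd_pow_self p (by omega)) hv).symm
  have h := PadicInt.mul_inv hn
  simp only [fracShift]
  push_cast
  linear_combination (k : ℤ_[p]) * h

theorem abs_sum_fracShift_le {v : ℕ} (hv : v.Coprime (p ^ e)) (he : 1 ≤ e) (α : ℤ_[p])
    {f : ℤ_[p] → ℝ} {B : ℝ} (hB : 0 ≤ B) (m : ℕ)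
    (hf : ∀ l ≤ m, ∀ z, (p : ℤ_[p]) ^ (e * l) ∣ z →
      |∑ r ∈ range ((p ^ e) ^ l), f (z + (r : ℕ))| ≤ B)
    {N : ℕ} (hN : N ≤ (p ^ e) ^ m) :
    |∑ n ∈ range N, f (fracShift p v α n)| ≤ v * (2 * ((m + 1) * (p ^ e : ℕ) * B)) := by
  have hv0 : 0 < v := by
    rcases Nat.eq_zero_or_pos v with rfl | h
    · have : 2 ≤ p ^ e := hp.out.two_le.trans (Nat.le_self_pow (by omega) p)
      rw [Nat.coprime_zero_left] at hv
      omega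
    · exact h
  rw [sum_range_eq_sum_residues hv0]
  refine (abs_sum_le_sum_abs _ _).trans ((sum_le_card_nsmul _ _ _ fun ρ _ => ?_).trans_eq
    (by rw [card_range, nsmul_eq_mul]))
  simp only [fracShift_mul_add hv he]
  refine abs_sum_run_le he hB m hf _ (le_trans ?_ hN)
  rw [Nat.div_le_iff_le_mul_add_pred hv0]
  have := Nat.le_mul_of_pos_left N hv0
  omega

end Runs

end DigitalSeq

theorem corollary3 (s : ℕ) (hs : 1 ≤ s) (p : ℕ) [Fact p.Prime] (e : ℕ) (he : 1 ≤ e)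
    {F : Type*} [Field F] (hF : Nat.card F = p ^ e) (t : ℕ)
    (ψ : ℕ → Fin (p ^ e) ≃ F)
    (C : Fin s → ℕ → ℕ → F)
    (lam : Fin s → ℕ → F ≃ Fin (p ^ e))
    (hfin : DigitalSeq.FiniteRow C)
    (hC : DigitalSeq.HasQuality C (fun _ => t))
    (α : ℤ_[p]) (v : ℕ) (hv : Nat.Coprime v (p ^ e)) :
    DigitalSeq.IsLowDiscrepancy
      (DigitalSeq.digitalSequence p e ψ C lam (DigitalSeq.fracShift p v α)) := by
  classical
  have hp : p.Prime := Fact.out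
  have hq2 : 2 ≤ p ^ e := hp.two_le.trans (Nat.le_self_pow (by omega) p)
  have : Finite F := Nat.finite_of_card_ne_zero (by omega)
  have : Fintype F := Fintype.ofFinite F
  rw [Nat.card_eq_fintype_card] at hF
  set q : ℝ := ((p ^ e : ℕ) : ℝ) with hq
  have hq2' : (2 : ℝ) ≤ q := by rw [hq]; exact_mod_cast hq2
  have hlog2 : 0 < Real.log 2 := Real.log_pos one_lt_two
  -- `A * log N` bounds `m + 1` for the `m` with `q ^ (m - 1) ≤ N < q ^ m`
  set A : ℝ := 3 / Real.log 2 with hA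
  have hA0 : 0 ≤ A := by positivity
  set c : ℝ := v * (2 * (A * q * (q ^ t * (s * (q * A) ^ (s - 1))))) with hc
  have hc0 : 0 ≤ c := by positivity
  refine ⟨c + 1, by positivity, 0, fun N hN => ?_⟩
  have hN2 : (2 : ℝ) ≤ N := by exact_mod_cast hN
  have hN0 : (0 : ℝ) < N := by linarith
  have hlogN : Real.log 2 ≤ Real.log N := Real.log_le_log two_pos hN2
  set m := Nat.log (p ^ e) N + 1 with hm
  have hNm : N ≤ (p ^ e) ^ m := (Nat.lt_pow_succ_log_self (by omega) N).le
  have hmlog : (m : ℝ) + 1 ≤ A * Real.log N := by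
    have h1 : q ^ (m - 1) ≤ N := by
      rw [hq]; exact_mod_cast Nat.pow_log_le_self (p ^ e) (by omega)
    have h2 : (2 : ℝ) ^ (m - 1) ≤ N := (pow_le_pow_left₀ two_pos.le hq2' _).trans h1
    have h3 := Real.log_le_log (by positivity) h2
    rw [Real.log_pow] at h3
    have h4 : ((m - 1 : ℕ) : ℝ) = m - 1 := by simp [hm]
    rw [h4] at h3
    rw [hA, div_mul_eq_mul_div, le_div_iff₀ hlog2]
    linarith
  have hbound : (N : ℝ) * DigitalSeq.starDiscrepancy
      (DigitalSeq.digitalSequence p e ψ C lam (DigitalSeq.fracShift p v α)) N ≤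
      v * (2 * ((m + 1) * q * (q ^ t * (s * (q * m + 1) ^ (s - 1))))) := by
    rw [mul_comm, ← le_div_iff₀ hN0, DigitalSeq.starDiscrepancy]
    refine csSup_le ⟨_, 0, fun _ => true, by simp, rfl⟩ ?_
    rintro δ ⟨u, closed, hu, rfl⟩
    rw [le_div_iff₀ hN0, ← abs_of_pos hN0, ← abs_mul, abs_of_pos hN0, sub_mul,
      div_mul_cancel₀ _ hN0.ne']
    have h := DigitalSeq.abs_sum_fracShift_le hv he α
      (f := fun z => (if (fun i => Real.ofDigits (DigitalSeq.outputDigit p e ψ C lam z i)) ∈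
        DigitalSeq.originBox u closed then (1 : ℝ) else 0) - ∏ i, u i)
      (B := q ^ t * (s * (q * m + 1) ^ (s - 1))) (by positivity) m
      (fun l hl z hz => DigitalSeq.abs_sum_block_le (ψ := ψ) (lam := lam) hF hfin hC closed hu
        hl hz)
      hNm
    rw [Finset.sum_sub_distrib, Finset.sum_boole, Finset.sum_const, Finset.card_range,
      nsmul_eq_mul, mul_comm (N : ℝ)] at h
    simpa only [DigitalSeq.countIn, DigitalSeq.digitalSequence_eq_ofDigits] using h
  refine hbound.trans ?_
  have hlog0 : 0 ≤ Real.log N := hlog2.le.trans hlogN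
  have h5 : q * m + 1 ≤ q * A * Real.log N := by
    have := mul_le_mul_of_nonneg_left hmlog (by linarith : (0 : ℝ) ≤ q)
    linarith
  calc _ ≤ v * (2 * ((A * Real.log N) * q * (q ^ t * (s * (q * A * Real.log N) ^ (s - 1))))) := by
        gcongr
    _ = c * (Real.log N ^ (s - 1) * Real.log N) := by rw [hc, mul_pow (q * A)]; ring
    _ = c * Real.log N ^ s := by rw [← pow_succ, Nat.sub_add_cancel hs]
    _ ≤ _ := by rw [zero_mul, add_zero]; gcongr; linarith
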